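/- Notation. All functions are real-valued. Let $H$ be the Hilbert transform on $L^2(\mathbb R)$ (Fourier symbol $-i\,\mathrm{sgn}\,\xi$). Let $\mathscr H^1(\mathbb R)=\{f\in L^1(\mathbb R): Hf\in L^1(\mathbb R)\}$ with the norm $\|f\|_{L^1}+\|Hf\|_{L^1}$, let $X=\mathrm{CMO}(\mathbb R)$ be the closure of $C_c^\infty(\mathbb R)$ in $\mathrm{BMO}(\mathbb R)$, and let $\langle b,f\rangle$ be the duality pairing of $b\in X$ with $f\in\mathscr H^1(\mathbb R)=X^*$, that is, $\langle b,f\rangle=\lim_{N\to\infty}\int_{\mathbb R}\max(-N,\min(b,N))\,f$. For a real Hilbert space $E$ and a map $Q\colon E\to\mathscr H^1(\mathbb R)$ put $$\|b\|_{X_Q}=\sup_{\|\omega\|_E=1}\langle b,Q\omega\rangle\quad(b\in X),\qquad \|f\|_{X_Q^*}=\sup\{\langle b,f\rangle: b\in X,\ \|b\|_{X_Q}=1\}\quad(f\in\mathscr H^1(\mathbb R)),$$ $$\mathscr A_Q=\{\omega\in E:\ \|\omega\|_E=1,\ \|Q\omega\|_{X_Q^*}=1\}.$$ If $Q$ is Gâteaux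 differentiable with derivative $Q'_\omega$ at $\omega$, we say that $Q$ satisfies condition (S) if, whenever $\omega,\gamma\in\mathscr A_Q$ satisfy $Q\omega=Q\gamma$, one has $Q'_\omega(c\gamma)\neq0$ for some $c\in\mathbb R$ with $|c|=1$. Proposition. The formula $Q\omega=\omega^2-(H\omega)^2$ defines a Gâteaux differentiable map $Q\colon L^2(\mathbb R)\to\mathscr H^1(\mathbb R)$, and $Q$ satisfies condition (S). The formula $\tilde Q(\omega,\gamma)=\omega\gamma-H\omega\,H\gamma$ defines a Gâteaux differentiable map $\tilde Q\colon L^2(\mathbb R)\times L^2(\mathbb R)\to\mathscr H^1(\mathbb R)$, where $\|(\omega,\gamma)\|^2=\|\omega\|_{L^2}^2+\|\gamma\|_{L^2}^2$, and $\tilde Q$ does not satisfy condition (S). -/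

import Mathlib

open MeasureTheory Set Filter Topology
open scoped ENNReal FourierTransform

noncomputable section

namespace HilbertQuadratic

/-! ### The Hilbert transform on real-valued `L²(ℝ)` -/

/-- Real-valued `L¹(ℝ)`. -/
abbrev L1R : Type := Lp ℝ 1 (volume : Measure ℝ)

/-- Real-valued `L²(ℝ)`. -/
abbrev L2R : Type := Lp ℝ 2 (volume : Measure ℝ)

/-- Complex-valued `L²(ℝ)`. -/
abbrev L2C : Type := Lp ℂ 2 (volume : Measure ℝ)

/-- The Fourier symbol `-i sgn ξ` of the Hilbert transform (with the Fourier transform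
`∫ f(x) exp(-2πixξ) dx`, it is the symbol of convolution with `p.v. 1/(πx)`). -/
def hilbertSymbol (ξ : ℝ) : ℂ := -Complex.I * (Real.sign ξ : ℂ)

theorem measurable_hilbertSymbol : Measurable hilbertSymbol := by
  have h : Measurable Real.sign := by
    unfold Real.sign
    exact Measurable.ite measurableSet_Iio measurable_const
      (Measurable.ite measurableSet_Ioi measurable_const measurable_const)
  exact (Complex.measurable_ofReal.comp h).const_mul _

theorem memLp_hilbertSymbol : MemLp hilbertSymbol ∞ (volume : Measure ℝ) := by
  refine memLp_top_of_bound measurable_hilbertSymbol.aestronglyMeasurable 1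
    (Eventually.of_forall fun ξ => ?_)
  rcases Real.sign_apply_eq ξ with h | h | h <;> simp [hilbertSymbol, h]

/-- The symbol `-i sgn ξ` as an element of `L^∞(ℝ)`. -/
def hilbertSymbolLp : Lp ℂ ∞ (volume : Measure ℝ) := memLp_hilbertSymbol.toLp hilbertSymbol

/-- The Hilbert transform on complex `L²(ℝ)`: multiplication by `-i sgn ξ` on the Fourier side. -/
def hilbertC (f : L2C) : L2C := 𝓕⁻ ((hilbertSymbolLp • (𝓕 f : L2C) : L2C))

/-- The Hilbert transform on real-valued `L²(ℝ)`. (The transform of a real-valued function is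
real-valued, since the symbol satisfies `m(-ξ) = conj (m ξ)`; the real part only changes the
codomain.) -/
def hilbert (f : L2R) : L2R := Complex.reCLM.compLp (hilbertC (Complex.ofRealCLM.compLp f))

/-! ### The real Hardy space `ℋ¹(ℝ)` -/

/-- `IsL1Hilbert f g` says that `g = Hf`, for `f, g ∈ L¹(ℝ)`, expressed through the Fourier
transform: `ĝ(ξ) = -i sgn(ξ) f̂(ξ)` for all `ξ`. -/
def IsL1Hilbert (f g : L1R) : Prop :=
  ∀ ξ : ℝ, 𝓕 (fun x => (g x : ℂ)) ξ = hilbertSymbol ξ * 𝓕 (fun x => (f x : ℂ)) ξ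

theorem fourier_add_L1 (f g : L1R) (ξ : ℝ) :
    𝓕 (fun x => ((f + g : L1R) x : ℂ)) ξ
      = 𝓕 (fun x => (f x : ℂ)) ξ + 𝓕 (fun x => (g x : ℂ)) ξ := by
  have hf : Integrable (fun x => (f x : ℂ)) := (L1.integrable_coeFn f).ofReal
  have hg : Integrable (fun x => (g x : ℂ)) := (L1.integrable_coeFn g).ofReal
  simp only [Real.fourier_eq]
  rw [← integral_add ((Real.fourierIntegral_convergent_iff ξ).2 hf)
    ((Real.fourierIntegral_convergent_iff ξ).2 hg)]
  refine integral_congr_ae ?_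
  filter_upwards [Lp.coeFn_add f g] with x hx
  rw [hx, Pi.add_apply, Complex.ofReal_add, smul_add]

theorem fourier_smul_L1 (c : ℝ) (f : L1R) (ξ : ℝ) :
    𝓕 (fun x => ((c • f : L1R) x : ℂ)) ξ = (c : ℂ) * 𝓕 (fun x => (f x : ℂ)) ξ := by
  simp only [Real.fourier_eq]
  rw [← integral_const_mul]
  refine integral_congr_ae ?_
  filter_upwards [Lp.coeFn_smul c f] with x hx
  rw [hx, Pi.smul_apply, smul_eq_mul, Complex.ofReal_mul, Circle.smul_def, Circle.smul_def,
    smul_eq_mul, smul_eq_mul]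
  ring

/-- The real Hardy space `ℋ¹(ℝ) = {f ∈ L¹(ℝ) : Hf ∈ L¹(ℝ)}` with the norm `‖f‖₁ + ‖Hf‖₁`,
realised as the space of pairs `(f, Hf)`, that is, of boundary functions `f + iHf`. -/
def Hardy1 : Submodule ℝ (WithLp 1 (L1R × L1R)) where
  carrier := {p | IsL1Hilbert p.fst p.snd}
  zero_mem' := by
    intro ξ
    have h := fourier_smul_L1 0 0 ξ
    rw [zero_smul, Complex.ofReal_zero, zero_mul] at h
    change 𝓕 (fun x => ((0 : L1R) x : ℂ)) ξ = _ * 𝓕 (fun x => ((0 : L1R) x : ℂ)) ξ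
    rw [h, mul_zero]
  add_mem' := by
    intro p q hp hq ξ
    change 𝓕 (fun x => ((p.snd + q.snd : L1R) x : ℂ)) ξ
      = _ * 𝓕 (fun x => ((p.fst + q.fst : L1R) x : ℂ)) ξ
    rw [fourier_add_L1, fourier_add_L1, hp ξ, hq ξ, mul_add]
  smul_mem' := by
    intro c p hp ξ
    change 𝓕 (fun x => ((c • p.snd : L1R) x : ℂ)) ξ
      = _ * 𝓕 (fun x => ((c • p.fst : L1R) x : ℂ)) ξ
    rw [fourier_smul_L1, fourier_smul_L1, hp ξ]
    ring

/-- The underlying integrable function of an element of `ℋ¹(ℝ)`. -/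
def Hardy1.fn (f : Hardy1) : L1R := (f : WithLp 1 (L1R × L1R)).fst

/-! ### `CMO(ℝ)` and its pairing with `ℋ¹(ℝ)` -/

/-- The `BMO` seminorm: the supremum of the mean oscillations over bounded intervals. -/
def bmoNorm (b : ℝ → ℝ) : ℝ≥0∞ :=
  ⨆ (a : ℝ) (c : ℝ) (_ : a < c), ⨍⁻ x in Icc a c, ‖b x - ⨍ y in Icc a c, b y‖ₑ ∂volume

/-- `b ∈ BMO(ℝ)`. -/
def IsBMO (b : ℝ → ℝ) : Prop := LocallyIntegrable b ∧ bmoNorm b < ∞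

/-- `b ∈ CMO(ℝ)`, the closure of `C_c^∞(ℝ)` in `BMO(ℝ)`. -/
def IsCMO (b : ℝ → ℝ) : Prop :=
  IsBMO b ∧ ∀ ε : ℝ≥0∞, 0 < ε →
    ∃ φ : ℝ → ℝ, ContDiff ℝ (⊤ : ℕ∞) φ ∧ HasCompactSupport φ ∧
      bmoNorm (fun x => b x - φ x) < ε

/-- The duality pairing `⟨b, f⟩` of `b ∈ BMO(ℝ)` (in particular of `b ∈ CMO(ℝ)`) with
`f ∈ ℋ¹(ℝ)`: the limit of `∫ b_N f`, where `b_N` is the truncation of `b` at height `±N`. For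
bounded `b` it is `∫ b f`. -/
def pairing (b : ℝ → ℝ) (f : Hardy1) : ℝ :=
  limUnder atTop fun N : ℕ => ∫ x, max (-(N : ℝ)) (min (b x) N) * Hardy1.fn f x

/-! ### The norms induced by a quadratic operator, and the condition -/

section Framework

variable {E : Type*} [NormedAddCommGroup E] [NormedSpace ℝ E]

/-- `‖b‖_{X_Q} = sup_{‖ω‖ = 1} ⟨b, Qω⟩`. -/
def normXQ (Q : E → Hardy1) (b : ℝ → ℝ) : EReal :=
  ⨆ ω ∈ Metric.sphere (0 : E) 1, (pairing b (Q ω) : EReal)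

/-- The dual norm `‖f‖_{X_Q^*} = sup {⟨b, f⟩ : b ∈ X, ‖b‖_{X_Q} = 1}`, where `X = CMO(ℝ)`. -/
def dualNormXQ (Q : E → Hardy1) (f : Hardy1) : EReal :=
  ⨆ b ∈ {b : ℝ → ℝ | IsCMO b ∧ normXQ Q b = 1}, (pairing b f : EReal)

/-- The class `𝒜` of all `ω` in the unit sphere such that `Qω` is in the unit sphere
of `X_Q^*`. -/
def classA (Q : E → Hardy1) : Set E :=
  {ω | ω ∈ Metric.sphere (0 : E) 1 ∧ dualNormXQ Q (Q ω) = 1}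

/-- `Q` has a Gâteaux derivative at every point: a bounded linear operator `L` such that
`(Q(ω + th) - Qω)/t → L h` in the norm of `ℋ¹(ℝ)` as `t → 0`, for every `h`. -/
def GateauxDifferentiable (Q : E → Hardy1) : Prop :=
  ∀ ω : E, ∃ L : E →L[ℝ] Hardy1, ∀ h : E, HasLineDerivAt ℝ Q (L h) ω h

/-- If `ω, γ ∈ 𝒜` satisfy `Qω = Qγ`, then the Gâteaux derivative satisfies `Q'_ω(cγ) ≠ 0` for
some unimodular scalar `c` (the scalar field of the Hilbert spaces considered is `ℝ`). -/
def SymmetryAssumption (Q : E → Hardy1) : Prop :=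
  ∀ ω ∈ classA Q, ∀ γ ∈ classA Q, Q ω = Q γ →
    ∃ c : ℝ, ‖c‖ = 1 ∧ lineDeriv ℝ Q ω (c • γ) ≠ 0

end Framework

end HilbertQuadratic

end

/-! Everything is read off the boundary functions `F_ω = ω + iHω` (`analyticSignal`). Their spectrum
is positive, and `F_ω F_γ` has real part `ωγ - HωHγ` and imaginary part `ωHγ + γHω`. The transform
of the product is the convolution of two functions supported on the positive half-line
(`fourier_mul_eq`), so the product again has positive spectrum. Hence its imaginary part is the
Hilbert transform of its real part, and `hardyForm` is a bilinear form with values in `ℋ¹`. Both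
Gâteaux derivatives come from expanding it.

For the quadratic operator, `Qω = Qγ` means `F_ω² = F_γ²`, and `Q'_ω γ = 0` means `F_ω F_γ = 0`.
Together they force `F_ω = 0` almost everywhere, which is impossible for a unit vector.

The bilinear operator sees only `F₁F₂`, so it is invariant under `(F₁, F₂) ↦ (iF₁, -iF₂)`, while its
derivative in the rotated direction is `F₁(-iF₂) + F₂(iF₁) = 0`. This refutes (S) as soon as the
class `𝒜` is nonempty. A member is found by duality: pairing with `cauchySymbol` gives `2 Re (F₁(z)
F₂(z))` at `z = i/(2π)`, which is at most `‖ω‖² + ‖γ‖²`, with equality when both components are the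
same real multiple of the function with transform `exp (-|ξ|)`. -/

noncomputable section

namespace HilbertQuadratic

open scoped ComplexConjugate

/-! ### The Fourier transform on `L²(ℝ)` -/

/-- The reflection `f ↦ f(-·)` on complex `L²(ℝ)`. -/
def reflL : L2C →ₗᵢ[ℂ] L2C :=
  Lp.compMeasurePreservingₗᵢ ℂ (fun x : ℝ => -x) (Measure.measurePreserving_neg volume)

theorem coeFn_reflL (f : L2C) : reflL f =ᵐ[volume] fun x => f (-x) :=
  Lp.coeFn_compMeasurePreserving f (Measure.measurePreserving_neg volume)

/-- Complex conjugation on complex `L²(ℝ)`. -/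
def conjL : L2C →L[ℝ] L2C := (Complex.conjCLE : ℂ →L[ℝ] ℂ).compLpL 2 volume

theorem coeFn_conjL (f : L2C) : conjL f =ᵐ[volume] fun x => conj (f x) :=
  (Complex.conjCLE : ℂ →L[ℝ] ℂ).coeFn_compLpL f

theorem L2C_induction {p : L2C → Prop} (hc : IsClosed {f | p f})
    (h : ∀ φ : SchwartzMap ℝ ℂ, p (φ.toLp 2)) (f : L2C) : p f :=
  DenseRange.induction_on (p := p)
    (SchwartzMap.denseRange_toLpCLM (F := ℂ) (E := ℝ) (μ := volume) (p := 2)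
      ENNReal.ofNat_ne_top) f hc h

theorem reflL_fourier (f : L2C) : reflL (𝓕 f) = 𝓕⁻ f := by
  revert f
  refine L2C_induction (isClosed_eq ?_ ?_) fun φ => ?_
  · exact reflL.continuous.comp (Lp.fourierTransformₗᵢ ℝ ℂ).continuous
  · exact (Lp.fourierTransformₗᵢ ℝ ℂ).symm.continuous
  · rw [SchwartzMap.toLp_fourier_eq, SchwartzMap.toLp_fourierInv_eq]
    refine Lp.ext ?_
    have h1 := (SchwartzMap.coeFn_toLp (𝓕 φ) 2 (μ := volume))
    have h2 := (Measure.measurePreserving_neg (volume : Measure ℝ)).quasiMeasurePreserving.ae h1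
    filter_upwards [coeFn_reflL ((𝓕 φ).toLp 2), h2, SchwartzMap.coeFn_toLp (𝓕⁻ φ) 2 (μ := volume)]
      with x hx h2 h3
    rw [hx, h2, h3]
    rfl

theorem reflL_reflL (f : L2C) : reflL (reflL f) = f := by
  refine Lp.ext ?_
  have h2 := (Measure.measurePreserving_neg (volume : Measure ℝ)).quasiMeasurePreserving.ae
    (coeFn_reflL f)
  filter_upwards [coeFn_reflL (reflL f), h2] with x hx h2
  rw [hx, h2, neg_neg]

theorem reflL_fourierInv (f : L2C) : reflL (𝓕⁻ f) = 𝓕 f := by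
  rw [← reflL_fourier, reflL_reflL]

theorem fourierInv_reflL (f : L2C) : 𝓕⁻ (reflL f) = 𝓕 f := by
  have h := reflL_fourier (𝓕⁻ (reflL f))
  rw [FourierTransform.fourier_fourierInv_eq, reflL_reflL] at h
  conv_rhs => rw [h]
  exact (FourierTransform.fourier_fourierInv_eq _).symm

/-- `∫ f g` as a continuous bilinear form on complex `L²(ℝ)`. -/
def bilinL : L2C →L[ℂ] L2C →L[ℂ] ℂ := (ContinuousLinearMap.mul ℂ ℂ).lpPairing volume 2 2

theorem bilinL_apply (f g : L2C) : bilinL f g = ∫ x, f x * g x :=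
  ContinuousLinearMap.lpPairing_eq_integral _ f g

theorem bilinL_fourier (f g : L2C) : bilinL (𝓕 f) g = bilinL f (𝓕 g) := by
  have hF : Continuous (fun f : L2C => (𝓕 f : L2C)) := (Lp.fourierTransformₗᵢ ℝ ℂ).continuous
  revert f
  refine L2C_induction (isClosed_eq (by fun_prop) (by fun_prop)) fun φ => ?_
  revert g
  refine L2C_induction (isClosed_eq (by fun_prop) (by fun_prop)) fun ψ => ?_
  rw [SchwartzMap.toLp_fourier_eq, SchwartzMap.toLp_fourier_eq, bilinL_apply, bilinL_apply]
  have := SchwartzMap.integral_fourier_mul_eq φ ψ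
  rw [integral_congr_ae (g := fun x => 𝓕 φ x * ψ x), this]
  · refine integral_congr_ae ?_
    filter_upwards [SchwartzMap.coeFn_toLp φ 2 (μ := volume),
      SchwartzMap.coeFn_toLp (𝓕 ψ) 2 (μ := volume)] with x h1 h2
    rw [h1, h2]
  · filter_upwards [SchwartzMap.coeFn_toLp (𝓕 φ) 2 (μ := volume),
      SchwartzMap.coeFn_toLp ψ 2 (μ := volume)] with x h1 h2
    rw [h1, h2]

theorem inner_conjL (f g : L2C) : inner ℂ (conjL f) g = bilinL f g := by
  rw [L2.inner_def, bilinL_apply]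
  refine integral_congr_ae ?_
  filter_upwards [coeFn_conjL f] with x hx
  simp [hx, mul_comm]

/-- Tested against `g`: conjugation turns the inner product into the bilinear form, across which the
Fourier transform moves to `g`; Plancherel moves it back as an inverse. -/
theorem conjL_fourier (f : L2C) : conjL (𝓕 f) = 𝓕⁻ (conjL f) := by
  refine ext_inner_right ℂ fun g => ?_
  rw [inner_conjL, bilinL_fourier, ← inner_conjL, ← Lp.inner_fourier_eq (𝓕⁻ (conjL f)),
    FourierTransform.fourier_fourierInv_eq]

theorem conjL_conjL (f : L2C) : conjL (conjL f) = f := by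
  refine Lp.ext ?_
  filter_upwards [coeFn_conjL (conjL f), coeFn_conjL f] with x h1 h2
  rw [h1, h2, Complex.conj_conj]

theorem conjL_fourierInv (f : L2C) : conjL (𝓕⁻ f) = 𝓕 (conjL f) := by
  have h := conjL_fourier (conjL f)
  rw [conjL_conjL] at h
  rw [← h, conjL_conjL]

/-- The Fourier transform of a product of two square-integrable functions is the convolution of
their Fourier transforms. -/
theorem fourier_mul_eq (f g : L2C) (ξ : ℝ) :
    𝓕 (fun x => f x * g x) ξ = ∫ η, (𝓕 f : L2C) η * (𝓕 g : L2C) (ξ - η) := by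
  have hF : Continuous (fun f : L2C => (𝓕 f : L2C)) := (Lp.fourierTransformₗᵢ ℝ ℂ).continuous
  let S : L2C →ₗᵢ[ℂ] L2C := Lp.compMeasurePreservingₗᵢ ℂ (fun x : ℝ => ξ - x)
    (Measure.measurePreserving_sub_left volume ξ)
  have hS : ∀ g : L2C, S g =ᵐ[volume] fun x => g (ξ - x) := fun g =>
    Lp.coeFn_compMeasurePreserving g (Measure.measurePreserving_sub_left volume ξ)
  let M : L2C →L[ℂ] L2C →L[ℂ] Lp ℂ 1 (volume : Measure ℝ) :=
    (ContinuousLinearMap.mul ℂ ℂ).holderL volume 2 2 1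
  have hM : ∀ f g : L2C, M f g =ᵐ[volume] fun x => f x * g x := fun f g =>
    (ContinuousLinearMap.mul ℂ ℂ).coeFn_holder f g
  let T : Lp ℂ 1 (volume : Measure ℝ) →L[ℂ] BoundedContinuousFunction ℝ ℂ :=
    Real.Lp.fourierTransformCLM ℝ ℂ
  -- For fixed `ξ` both sides are continuous in each of `f`, `g` in `L²`, so density reduces the
  -- identity to Schwartz functions.
  suffices h : ∀ f g : L2C, T (M f g) ξ = bilinL (𝓕 f) (S (𝓕 g)) by
    have h1 := h f g
    rw [bilinL_apply] at h1
    have h2 : T (M f g) ξ = 𝓕 (fun x => f x * g x) ξ := Real.fourier_congr_ae (hM f g) ξ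
    rw [← h2, h1]
    refine integral_congr_ae ?_
    filter_upwards [hS (𝓕 g)] with x hx
    rw [hx]
  have hT : Continuous fun u => T u ξ :=
    (BoundedContinuousFunction.evalCLM ℂ ξ).continuous.comp T.continuous
  intro f g
  revert f
  refine L2C_induction (isClosed_eq (hT.comp (by fun_prop)) (by fun_prop)) fun φ => ?_
  revert g
  refine L2C_induction (isClosed_eq (hT.comp (by fun_prop))
    ((bilinL _).continuous.comp (S.continuous.comp hF))) fun ψ => ?_
  have h2 : T (M (φ.toLp 2) (ψ.toLp 2)) ξ = 𝓕 (fun x => φ x * ψ x) ξ := by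
    refine Real.fourier_congr_ae ?_ ξ
    filter_upwards [hM (φ.toLp 2) (ψ.toLp 2), SchwartzMap.coeFn_toLp φ 2 (μ := volume),
      SchwartzMap.coeFn_toLp ψ 2 (μ := volume)] with x h1 h2 h3
    rw [h1, h2, h3]
  have h3 := SchwartzMap.convolution_apply (ContinuousLinearMap.mul ℂ ℂ) (𝓕 φ) (𝓕 ψ) ξ
  have hneg : ∀ (χ : SchwartzMap ℝ ℂ) (x : ℝ), 𝓕 (𝓕 χ) x = χ (-x) := fun χ x => by
    have h : (𝓕⁻ (𝓕 χ) : SchwartzMap ℝ ℂ) (-x) = 𝓕 (𝓕 χ) (-(-x)) := rfl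
    rw [FourierTransform.fourierInv_fourier_eq, neg_neg] at h
    exact h.symm
  -- The Schwartz convolution unfolds to the inverse transform of the product of transforms;
  -- applying the transform twice reflects `φ` and `ψ`, and the inverse transform undoes the
  -- reflection.
  have h4 : SchwartzMap.convolution (ContinuousLinearMap.mul ℂ ℂ) (𝓕 φ) (𝓕 ψ) ξ
      = 𝓕 (fun x => φ x * ψ x) ξ := by
    change (𝓕⁻ (SchwartzMap.pairing (ContinuousLinearMap.mul ℂ ℂ) (𝓕 (𝓕 φ)) (𝓕 (𝓕 ψ))) :
      SchwartzMap ℝ ℂ) ξ = _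
    rw [SchwartzMap.fourierInv_coe, Real.fourierInv_eq_fourier_comp_neg]
    simp [hneg]
  rw [h2, ← h4, h3, SchwartzMap.toLp_fourier_eq, SchwartzMap.toLp_fourier_eq, bilinL_apply]
  refine integral_congr_ae ?_
  have h5 := (Measure.measurePreserving_sub_left (volume : Measure ℝ) ξ).quasiMeasurePreserving.ae
    (SchwartzMap.coeFn_toLp (𝓕 ψ) 2 (μ := volume))
  filter_upwards [hS ((𝓕 ψ).toLp 2), SchwartzMap.coeFn_toLp (𝓕 φ) 2 (μ := volume), h5]
    with x h1 h2 h3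
  rw [h1, h2, h3]
  rfl

/-! ### The Hilbert transform as a linear isometry -/

theorem coeFn_hilbertSymbolLp_smul (f : L2C) :
    (hilbertSymbolLp • f : L2C) =ᵐ[volume] fun ξ => hilbertSymbol ξ * f ξ := by
  filter_upwards [Lp.coeFn_lpSMul (r := 2) hilbertSymbolLp f,
    memLp_hilbertSymbol.coeFn_toLp] with ξ h1 h2
  rw [h1, Pi.smul_apply', smul_eq_mul, hilbertSymbolLp, h2]

theorem fourier_hilbertC (f : L2C) : 𝓕 (hilbertC f) = (hilbertSymbolLp • (𝓕 f : L2C) : L2C) :=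
  FourierTransform.fourier_fourierInv_eq _

theorem hilbertSymbol_neg (ξ : ℝ) : hilbertSymbol (-ξ) = conj (hilbertSymbol ξ) := by
  simp [hilbertSymbol, Real.sign_neg]

theorem conjL_reflL_hilbertSymbolLp_smul (f : L2C) :
    conjL (reflL (hilbertSymbolLp • f : L2C)) = (hilbertSymbolLp • conjL (reflL f) : L2C) := by
  refine Lp.ext ?_
  have h2 := (Measure.measurePreserving_neg (volume : Measure ℝ)).quasiMeasurePreserving.ae
    (coeFn_hilbertSymbolLp_smul f)
  filter_upwards [coeFn_conjL (reflL (hilbertSymbolLp • f : L2C)),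
    coeFn_reflL (hilbertSymbolLp • f : L2C), h2, coeFn_hilbertSymbolLp_smul (conjL (reflL f)),
    coeFn_conjL (reflL f), coeFn_reflL f] with x h1 h2 h3 h4 h5 h6
  rw [h1, h2, h3, h4, h5, h6, map_mul, hilbertSymbol_neg, Complex.conj_conj]

theorem fourierInv_conjL_reflL (f : L2C) : 𝓕⁻ (conjL (reflL f)) = conjL (𝓕⁻ f) := by
  rw [← conjL_fourier, ← reflL_fourierInv, reflL_fourierInv, ← fourierInv_reflL, reflL_reflL]

theorem fourier_conjL (f : L2C) : 𝓕 (conjL f) = conjL (reflL (𝓕 f)) := by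
  rw [reflL_fourier, conjL_fourierInv]

/-- Rests on `m(-ξ) = conj (m ξ)`. It shows that taking the real part in `hilbert` loses nothing
(`ofRealL_hilbert`). -/
theorem hilbertC_conjL (f : L2C) : hilbertC (conjL f) = conjL (hilbertC f) := by
  rw [hilbertC, fourier_conjL, ← conjL_reflL_hilbertSymbolLp_smul, fourierInv_conjL_reflL, hilbertC]

/-- The inclusion of real `L²(ℝ)` into complex `L²(ℝ)`. -/
def ofRealL : L2R →L[ℝ] L2C := Complex.ofRealCLM.compLpL 2 volume

theorem coeFn_ofRealL (f : L2R) : ofRealL f =ᵐ[volume] fun x => (f x : ℂ) :=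
  Complex.ofRealCLM.coeFn_compLpL f

theorem ofRealL_injective : Function.Injective ofRealL := fun f g h => by
  refine Lp.ext ?_
  filter_upwards [coeFn_ofRealL f, coeFn_ofRealL g] with x h1 h2
  rw [h] at h1
  exact_mod_cast h1.symm.trans h2

theorem norm_ofRealL (f : L2R) : ‖ofRealL f‖ = ‖f‖ := by
  rw [Lp.norm_def, Lp.norm_def]
  congr 1
  refine eLpNorm_congr_norm_ae ?_
  filter_upwards [coeFn_ofRealL f] with x h
  rw [h, Complex.norm_real]

theorem conjL_ofRealL (f : L2R) : conjL (ofRealL f) = ofRealL f := by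
  refine Lp.ext ?_
  filter_upwards [coeFn_conjL (ofRealL f), coeFn_ofRealL f] with x h1 h2
  rw [h1, h2, Complex.conj_ofReal]

theorem ofRealL_re_of_conjL_eq {f : L2C} (h : conjL f = f) :
    ofRealL (Complex.reCLM.compLp f) = f := by
  refine Lp.ext ?_
  filter_upwards [coeFn_ofRealL (Complex.reCLM.compLp f), Complex.reCLM.coeFn_compLp f,
    coeFn_conjL f] with x h1 h2 h3
  rw [h1, h2]
  rw [h] at h3
  exact Complex.conj_eq_iff_re.1 h3.symm

theorem ofRealL_hilbert (f : L2R) : ofRealL (hilbert f) = hilbertC (ofRealL f) := by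
  refine ofRealL_re_of_conjL_eq ?_
  change conjL (hilbertC (ofRealL f)) = _
  rw [← hilbertC_conjL, conjL_ofRealL]
  rfl

theorem hilbertC_add (f g : L2C) : hilbertC (f + g) = hilbertC f + hilbertC g := by
  have h : (hilbertSymbolLp • (𝓕 f + 𝓕 g : L2C) : L2C)
      = (hilbertSymbolLp • (𝓕 f : L2C) : L2C) + (hilbertSymbolLp • (𝓕 g : L2C) : L2C) :=
    Lp.add_smul _ _ _
  rw [hilbertC, FourierTransform.fourier_add, h, FourierTransform.fourierInv_add]
  rfl

theorem hilbertC_smul (c : ℂ) (f : L2C) : hilbertC (c • f) = c • hilbertC f := by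
  have h : (hilbertSymbolLp • (c • 𝓕 f : L2C) : L2C)
      = c • (hilbertSymbolLp • (𝓕 f : L2C) : L2C) := (Lp.smul_comm c _ _).symm
  rw [hilbertC, FourierTransform.fourier_smul, h, FourierTransform.fourierInv_smul]
  rfl

theorem norm_hilbertSymbol {ξ : ℝ} (h : ξ ≠ 0) : ‖hilbertSymbol ξ‖ = 1 := by
  rcases Real.sign_apply_eq_of_ne_zero ξ h with h | h <;> simp [hilbertSymbol, h]

theorem norm_hilbertC (f : L2C) : ‖hilbertC f‖ = ‖f‖ := by
  rw [← Lp.norm_fourier_eq (hilbertC f), fourier_hilbertC, ← Lp.norm_fourier_eq f,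
    Lp.norm_def, Lp.norm_def]
  congr 1
  refine eLpNorm_congr_norm_ae ?_
  filter_upwards [coeFn_hilbertSymbolLp_smul (𝓕 f), Measure.ae_ne volume (0 : ℝ)] with x h h0
  rw [h, norm_mul, norm_hilbertSymbol h0, one_mul]

theorem hilbertC_hilbertC (f : L2C) : hilbertC (hilbertC f) = -f := by
  have h : 𝓕 (hilbertC (hilbertC f)) = 𝓕 (-f) := by
    rw [fourier_hilbertC, fourier_hilbertC, FourierTransform.fourier_neg]
    refine Lp.ext ?_
    filter_upwards [coeFn_hilbertSymbolLp_smul (hilbertSymbolLp • (𝓕 f : L2C) : L2C),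
      coeFn_hilbertSymbolLp_smul (𝓕 f), Lp.coeFn_neg (𝓕 f : L2C), Measure.ae_ne volume (0 : ℝ)]
      with x h1 h2 h3 h0
    rw [h1, h2, h3, Pi.neg_apply]
    rcases Real.sign_apply_eq_of_ne_zero x h0 with h | h <;> simp [hilbertSymbol, h, ← mul_assoc]
  exact (Lp.fourierTransformₗᵢ ℝ ℂ).injective h

/-- The Hilbert transform on real `L²(ℝ)` as a linear isometry. -/
def hilbertLI : L2R →ₗᵢ[ℝ] L2R where
  toFun := hilbert
  map_add' f g := ofRealL_injective <| by
    simp only [map_add, ofRealL_hilbert, hilbertC_add]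
  map_smul' c f := ofRealL_injective <| by
    have h : ∀ f : L2R, ofRealL (c • f) = (c : ℂ) • ofRealL f := fun f => by
      rw [map_smul]; rfl
    rw [RingHom.id_apply, h, ofRealL_hilbert, ofRealL_hilbert, h, hilbertC_smul]
  norm_map' f := by
    change ‖hilbert f‖ = ‖f‖
    rw [← norm_ofRealL, ofRealL_hilbert, norm_hilbertC, norm_ofRealL]

theorem norm_hilbert (f : L2R) : ‖hilbert f‖ = ‖f‖ := hilbertLI.norm_map f

theorem hilbert_neg (f : L2R) : hilbert (-f) = -hilbert f := map_neg hilbertLI f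

theorem hilbert_hilbert (f : L2R) : hilbert (hilbert f) = -f :=
  ofRealL_injective <| by rw [ofRealL_hilbert, ofRealL_hilbert, hilbertC_hilbertC, map_neg]

/-- The boundary function `f + iHf` of an element of the Hardy space `H²`. -/
def analyticSignal (f : L2R) : L2C := ofRealL f + Complex.I • ofRealL (hilbert f)

theorem coeFn_analyticSignal (f : L2R) :
    analyticSignal f =ᵐ[volume] fun x => (f x : ℂ) + Complex.I * hilbert f x := by
  filter_upwards [Lp.coeFn_add (ofRealL f) (Complex.I • ofRealL (hilbert f)),
    Lp.coeFn_smul Complex.I (ofRealL (hilbert f)), coeFn_ofRealL f, coeFn_ofRealL (hilbert f)]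
    with x h1 h2 h3 h4
  rw [analyticSignal, h1, Pi.add_apply, h2, Pi.smul_apply, h3, h4, smul_eq_mul]

theorem fourier_analyticSignal (f : L2R) :
    (𝓕 (analyticSignal f) : L2C) =ᵐ[volume]
      fun ξ => (1 + (Real.sign ξ : ℂ)) * (𝓕 (ofRealL f) : L2C) ξ := by
  rw [analyticSignal, FourierTransform.fourier_add, FourierTransform.fourier_smul,
    ofRealL_hilbert, fourier_hilbertC]
  filter_upwards [Lp.coeFn_add (𝓕 (ofRealL f) : L2C)
      (Complex.I • (hilbertSymbolLp • (𝓕 (ofRealL f) : L2C) : L2C)),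
    Lp.coeFn_smul Complex.I (hilbertSymbolLp • (𝓕 (ofRealL f) : L2C) : L2C),
    coeFn_hilbertSymbolLp_smul (𝓕 (ofRealL f))] with x h1 h2 h3
  rw [h1, Pi.add_apply, h2, Pi.smul_apply, h3, smul_eq_mul, hilbertSymbol]
  linear_combination (-(Real.sign x : ℂ) * (𝓕 (ofRealL f) : L2C) x) * Complex.I_mul_I

/-- The multiplier `1 + sgn ξ` vanishes for `ξ < 0`, and the point `0` is null. -/
theorem fourier_analyticSignal_of_nonpos (f : L2R) :
    ∀ᵐ ξ : ℝ, ξ ≤ 0 → (𝓕 (analyticSignal f) : L2C) ξ = 0 := by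
  filter_upwards [fourier_analyticSignal f, Measure.ae_ne volume (0 : ℝ)] with ξ h h0 hξ
  rw [h, Real.sign_of_neg (lt_of_le_of_ne hξ h0)]
  simp

theorem norm_sq_eq_integral (f : L2C) : ‖f‖ ^ 2 = ∫ x, ‖f x‖ ^ 2 := by
  have h := inner_self_eq_norm_sq_to_K (𝕜 := ℂ) f
  rw [L2.inner_def] at h
  simp only [inner_self_eq_norm_sq_to_K] at h
  have h2 : ∀ x, ((‖f x‖ : ℂ)) ^ 2 = ((‖f x‖ ^ 2 : ℝ) : ℂ) := fun x => by push_cast; rfl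
  simp only [Complex.coe_algebraMap] at h
  simp only [h2] at h
  rw [integral_complex_ofReal] at h
  exact_mod_cast h.symm

theorem integrable_norm_sq (f : L2C) : Integrable fun x => ‖f x‖ ^ 2 :=
  (memLp_two_iff_integrable_sq_norm (Lp.aestronglyMeasurable f)).1 (Lp.memLp f)

/-- Pointwise `|f + iHf|² = f² + (Hf)²`, and `H` is an isometry. -/
theorem norm_analyticSignal_sq (f : L2R) : ‖analyticSignal f‖ ^ 2 = 2 * ‖f‖ ^ 2 := by
  have h : ‖analyticSignal f‖ ^ 2 = ‖ofRealL f‖ ^ 2 + ‖ofRealL (hilbert f)‖ ^ 2 := by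
    simp only [norm_sq_eq_integral]
    rw [← integral_add (integrable_norm_sq _) (integrable_norm_sq _)]
    refine integral_congr_ae ?_
    filter_upwards [coeFn_analyticSignal f, coeFn_ofRealL f, coeFn_ofRealL (hilbert f)]
      with x h1 h2 h3
    rw [h1, h2, h3]
    simp only [← Complex.normSq_eq_norm_sq, Complex.normSq_apply]
    simp
  rw [h, norm_ofRealL, norm_ofRealL, norm_hilbert]
  ring

/-! ### The bilinear form `(ω, γ) ↦ ωγ - HωHγ` with values in `ℋ¹(ℝ)` -/

theorem fourier_ofReal_neg (f : L1R) (ξ : ℝ) :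
    𝓕 (fun x => (f x : ℂ)) (-ξ) = conj (𝓕 (fun x => (f x : ℂ)) ξ) := by
  simp only [Real.fourier_real_eq_integral_exp_smul]
  rw [← integral_conj]
  refine integral_congr_ae (Eventually.of_forall fun x => ?_)
  simp only [smul_eq_mul, map_mul, Complex.conj_ofReal, ← Complex.exp_conj, Complex.conj_I]
  push_cast
  ring_nf

/-- A complex integrable function whose spectrum is positive has imaginary part equal to the
Hilbert transform of its real part. -/
theorem isL1Hilbert_of_fourier_eq_zero {f g : L1R}
    (h : ∀ ξ ≤ 0, 𝓕 (fun x => (f x : ℂ) + Complex.I * g x) ξ = 0) : IsL1Hilbert f g := by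
  have hf : Integrable (fun x => (f x : ℂ)) := (L1.integrable_coeFn f).ofReal
  have hg : Integrable (fun x => (g x : ℂ)) := (L1.integrable_coeFn g).ofReal
  have hadd : ∀ ξ, 𝓕 (fun x => (f x : ℂ) + Complex.I * g x) ξ
      = 𝓕 (fun x => (f x : ℂ)) ξ + Complex.I * 𝓕 (fun x => (g x : ℂ)) ξ := fun ξ => by
    simp only [Real.fourier_eq]
    rw [← integral_const_mul, ← integral_add ((Real.fourierIntegral_convergent_iff ξ).2 hf)
      (((Real.fourierIntegral_convergent_iff ξ).2 hg).const_mul _)]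
    refine integral_congr_ae (Eventually.of_forall fun x => ?_)
    simp only [Circle.smul_def, smul_eq_mul]
    ring
  have key : ∀ ξ ≤ 0, 𝓕 (fun x => (g x : ℂ)) ξ = Complex.I * 𝓕 (fun x => (f x : ℂ)) ξ :=
    fun ξ hξ => by
      have := h ξ hξ
      rw [hadd] at this
      linear_combination (-Complex.I) * this + 𝓕 (fun x => (g x : ℂ)) ξ * Complex.I_mul_I
  intro ξ
  rcases lt_trichotomy ξ 0 with hξ | rfl | hξ
  · rw [key ξ hξ.le, hilbertSymbol, Real.sign_of_neg hξ]
    simp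
  -- The symbol is `0` at the origin, so `ĝ(0) = 0` is needed: `f̂(0)` and `ĝ(0)` are both real, yet
  -- `ĝ(0) = i f̂(0)`.
  · have h1 := key 0 le_rfl
    have hf0 := fourier_ofReal_neg f 0
    have hg0 := fourier_ofReal_neg g 0
    rw [neg_zero] at hf0 hg0
    rw [h1, map_mul, ← hf0, Complex.conj_I] at hg0
    rw [h1]
    have h2 : Complex.I * 𝓕 (fun x => (f x : ℂ)) 0 = 0 := by linear_combination hg0 / 2
    rw [h2]
    simp [hilbertSymbol, Real.sign_zero]
  -- Positive frequencies follow from negative ones because `f` and `g` are real.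
  · have h1 := congrArg conj (key (-ξ) (by linarith))
    rw [map_mul, ← fourier_ofReal_neg, ← fourier_ofReal_neg, neg_neg, Complex.conj_I] at h1
    rw [h1, hilbertSymbol, Real.sign_of_pos hξ]
    simp

/-- The product `L² × L² → L¹`. -/
def mulL : L2R →L[ℝ] L2R →L[ℝ] L1R := (ContinuousLinearMap.mul ℝ ℝ).holderL volume 2 2 1

theorem coeFn_mulL (f g : L2R) : mulL f g =ᵐ[volume] fun x => f x * g x :=
  (ContinuousLinearMap.mul ℝ ℝ).coeFn_holder f g

theorem mulL_comm (f g : L2R) : mulL f g = mulL g f := by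
  refine Lp.ext ?_
  filter_upwards [coeFn_mulL f g, coeFn_mulL g f] with x h1 h2
  rw [h1, h2, mul_comm]

/-- `γ ↦ ωγ - HωHγ`. -/
def reForm (ω : L2R) : L2R →L[ℝ] L1R :=
  mulL ω - (mulL (hilbert ω)).comp hilbertLI.toContinuousLinearMap

/-- `γ ↦ ωHγ + γHω`. -/
def imForm (ω : L2R) : L2R →L[ℝ] L1R :=
  (mulL ω).comp hilbertLI.toContinuousLinearMap + mulL (hilbert ω)

theorem reForm_apply (ω γ : L2R) :
    reForm ω γ = mulL ω γ - mulL (hilbert ω) (hilbert γ) := rfl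

theorem imForm_apply (ω γ : L2R) :
    imForm ω γ = mulL ω (hilbert γ) + mulL (hilbert ω) γ := rfl

theorem coeFn_reForm (ω γ : L2R) :
    reForm ω γ =ᵐ[volume] fun x => ω x * γ x - hilbert ω x * hilbert γ x := by
  rw [reForm_apply]
  filter_upwards [Lp.coeFn_sub (mulL ω γ) (mulL (hilbert ω) (hilbert γ)), coeFn_mulL ω γ,
    coeFn_mulL (hilbert ω) (hilbert γ)] with x h1 h2 h3
  rw [h1, Pi.sub_apply, h2, h3]

theorem coeFn_imForm (ω γ : L2R) :
    imForm ω γ =ᵐ[volume] fun x => ω x * hilbert γ x + hilbert ω x * γ x := by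
  rw [imForm_apply]
  filter_upwards [Lp.coeFn_add (mulL ω (hilbert γ)) (mulL (hilbert ω) γ),
    coeFn_mulL ω (hilbert γ), coeFn_mulL (hilbert ω) γ] with x h1 h2 h3
  rw [h1, Pi.add_apply, h2, h3]

theorem reForm_add_imForm (ω γ : L2R) :
    (fun x => (reForm ω γ x : ℂ) + Complex.I * imForm ω γ x)
      =ᵐ[volume] fun x => analyticSignal ω x * analyticSignal γ x := by
  filter_upwards [coeFn_reForm ω γ, coeFn_imForm ω γ, coeFn_analyticSignal ω,
    coeFn_analyticSignal γ] with x h1 h2 h3 h4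
  rw [h1, h2, h3, h4]
  push_cast
  linear_combination (-(hilbert ω x : ℂ) * hilbert γ x) * Complex.I_mul_I

/-- In the convolution integral `η` and `ξ - η` cannot both be positive when `ξ ≤ 0`. -/
theorem fourier_analyticSignal_mul_of_nonpos (ω γ : L2R) {ξ : ℝ} (hξ : ξ ≤ 0) :
    𝓕 (fun x => analyticSignal ω x * analyticSignal γ x) ξ = 0 := by
  rw [fourier_mul_eq]
  refine integral_eq_zero_of_ae ?_
  have h := (Measure.measurePreserving_sub_left (volume : Measure ℝ) ξ).quasiMeasurePreserving.ae
    (fourier_analyticSignal_of_nonpos γ)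
  filter_upwards [fourier_analyticSignal_of_nonpos ω, h] with η h1 h2
  rcases le_or_gt η 0 with h0 | h0
  · rw [h1 h0, zero_mul, Pi.zero_apply]
  · rw [h2 (by linarith), mul_zero, Pi.zero_apply]

theorem isL1Hilbert_reForm_imForm (ω γ : L2R) : IsL1Hilbert (reForm ω γ) (imForm ω γ) := by
  refine isL1Hilbert_of_fourier_eq_zero fun ξ hξ => ?_
  rw [Real.fourier_congr_ae (reForm_add_imForm ω γ), fourier_analyticSignal_mul_of_nonpos ω γ hξ]

/-- The map `γ ↦ ωγ - HωHγ` from `L²(ℝ)` to `ℋ¹(ℝ)`. -/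
def hardyForm (ω : L2R) : L2R →L[ℝ] Hardy1 :=
  (((WithLp.prodContinuousLinearEquiv 1 ℝ L1R L1R).symm :
    (L1R × L1R) →L[ℝ] WithLp 1 (L1R × L1R)).comp ((reForm ω).prod (imForm ω))).codRestrict Hardy1
    (isL1Hilbert_reForm_imForm ω)

theorem fn_hardyForm (ω γ : L2R) : Hardy1.fn (hardyForm ω γ) = reForm ω γ := rfl

theorem hardyForm_eq_iff {ω γ ω' γ' : L2R} :
    hardyForm ω γ = hardyForm ω' γ' ↔
      reForm ω γ = reForm ω' γ' ∧ imForm ω γ = imForm ω' γ' := by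
  constructor
  · intro h
    have h' : (hardyForm ω γ : WithLp 1 (L1R × L1R)) = hardyForm ω' γ' := by rw [h]
    exact ⟨congrArg (fun p => p.fst) h', congrArg (fun p => p.snd) h'⟩
  · rintro ⟨h1, h2⟩
    refine Subtype.ext ?_
    change WithLp.toLp 1 (reForm ω γ, imForm ω γ) = WithLp.toLp 1 (reForm ω' γ', imForm ω' γ')
    rw [h1, h2]

theorem hardyForm_comm (ω γ : L2R) : hardyForm ω γ = hardyForm γ ω := by
  refine hardyForm_eq_iff.2 ⟨?_, ?_⟩
  · rw [reForm_apply, reForm_apply, mulL_comm ω, mulL_comm (hilbert ω)]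
  · rw [imForm_apply, imForm_apply, mulL_comm ω, mulL_comm (hilbert ω), add_comm]

theorem mul_eq_of_hardyForm_eq {ω γ ω' γ' : L2R} (h : hardyForm ω γ = hardyForm ω' γ') :
    ∀ᵐ x, analyticSignal ω x * analyticSignal γ x
      = analyticSignal ω' x * analyticSignal γ' x := by
  obtain ⟨h1, h2⟩ := hardyForm_eq_iff.1 h
  filter_upwards [reForm_add_imForm ω γ, reForm_add_imForm ω' γ'] with x h3 h4
  rw [← h3, ← h4, h1, h2]

theorem hardyForm_add_left (ω ω' γ : L2R) :
    hardyForm (ω + ω') γ = hardyForm ω γ + hardyForm ω' γ := by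
  rw [hardyForm_comm, map_add, hardyForm_comm γ, hardyForm_comm γ]

theorem hardyForm_smul_left (c : ℝ) (ω γ : L2R) :
    hardyForm (c • ω) γ = c • hardyForm ω γ := by
  rw [hardyForm_comm, map_smul, hardyForm_comm γ]

theorem hardyForm_zero_left (γ : L2R) : hardyForm 0 γ = 0 := by
  rw [hardyForm_comm, map_zero]

/-! ### Gâteaux derivatives -/

/-- The bilinear operator `(ω, γ) ↦ ωγ - HωHγ` on `L²(ℝ) × L²(ℝ)`. -/
def bilinearOp (p : WithLp 2 (L2R × L2R)) : Hardy1 := hardyForm p.fst p.snd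

/-- The quadratic operator `ω ↦ ω² - (Hω)²`. -/
def quadraticOp (ω : L2R) : Hardy1 := hardyForm ω ω

/-- The Gâteaux derivative of `bilinearOp`. -/
def bilinearOpDeriv (p : WithLp 2 (L2R × L2R)) : WithLp 2 (L2R × L2R) →L[ℝ] Hardy1 :=
  (hardyForm p.fst).comp (WithLp.sndL 2 ℝ L2R L2R) + (hardyForm p.snd).comp (WithLp.fstL 2 ℝ L2R L2R)

theorem hasLineDerivAt_bilinearOp (p h : WithLp 2 (L2R × L2R)) :
    HasLineDerivAt ℝ bilinearOp (bilinearOpDeriv p h) p h := by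
  have hexp : ∀ t : ℝ, bilinearOp (p + t • h)
      = bilinearOp p + t • bilinearOpDeriv p h + (t ^ 2) • bilinearOp h := fun t => by
    change hardyForm (p.fst + t • h.fst) (p.snd + t • h.snd) = hardyForm p.fst p.snd
      + t • (hardyForm p.fst h.snd + hardyForm p.snd h.fst) + (t ^ 2) • hardyForm h.fst h.snd
    rw [hardyForm_add_left, hardyForm_smul_left, map_add, map_add, map_smul, map_smul,
      hardyForm_comm p.snd h.fst]
    module
  rw [HasLineDerivAt]
  simp only [hexp]
  have h1 : HasDerivAt (fun t : ℝ => t • bilinearOpDeriv p h) (bilinearOpDeriv p h) 0 := by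
    simpa using (hasDerivAt_id (0 : ℝ)).smul_const (bilinearOpDeriv p h)
  have h2 : HasDerivAt (fun t : ℝ => (t ^ 2) • bilinearOp h) (0 : Hardy1) 0 := by
    simpa using (hasDerivAt_pow 2 (0 : ℝ)).smul_const (bilinearOp h)
  have h3 := (h1.const_add (bilinearOp p)).add h2
  rw [add_zero] at h3
  exact h3

/-- The quadratic operator is the bilinear one restricted to the diagonal; symmetry produces the
factor `2`. -/
theorem hasLineDerivAt_quadraticOp (ω h : L2R) :
    HasLineDerivAt ℝ quadraticOp (((2 : ℝ) • hardyForm ω) h) ω h := by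
  have h0 := hasLineDerivAt_bilinearOp (WithLp.toLp 2 (ω, ω)) (WithLp.toLp 2 (h, h))
  have h1 : bilinearOpDeriv (WithLp.toLp 2 (ω, ω)) (WithLp.toLp 2 (h, h))
      = ((2 : ℝ) • hardyForm ω) h := by
    change hardyForm ω h + hardyForm ω h = (2 : ℝ) • hardyForm ω h
    rw [two_smul]
  rw [h1] at h0
  exact h0

theorem gateauxDifferentiable_bilinearOp : GateauxDifferentiable bilinearOp :=
  fun p => ⟨bilinearOpDeriv p, hasLineDerivAt_bilinearOp p⟩

theorem gateauxDifferentiable_quadraticOp : GateauxDifferentiable quadraticOp :=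
  fun ω => ⟨(2 : ℝ) • hardyForm ω, hasLineDerivAt_quadraticOp ω⟩

/-! ### The symmetry assumption for the quadratic operator -/

theorem analyticSignal_zero : analyticSignal 0 = 0 := by
  have h : hilbert 0 = 0 := map_zero hilbertLI
  rw [analyticSignal, h, map_zero, smul_zero, add_zero]

theorem symmetryAssumption_quadraticOp : SymmetryAssumption quadraticOp := by
  intro ω hω γ _ hQ
  refine ⟨1, by simp, fun h0 => ?_⟩
  rw [one_smul, (hasLineDerivAt_quadraticOp ω γ).lineDeriv, smul_apply,
    smul_eq_zero_iff_right two_ne_zero, ← hardyForm_zero_left γ] at h0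
  have hω0 : ω = 0 := by
    refine Lp.ext ?_
    filter_upwards [mul_eq_of_hardyForm_eq hQ, mul_eq_of_hardyForm_eq h0, coeFn_analyticSignal ω,
      Lp.coeFn_zero ℝ 2 (volume : Measure ℝ), Lp.coeFn_zero ℂ 2 (volume : Measure ℝ)]
      with x h1 h2 h3 h4 h5
    rw [analyticSignal_zero, h5, Pi.zero_apply, zero_mul] at h2
    -- From `F_ω F_γ = 0` either `F_ω` vanishes at `x`, or `F_γ` does and then `F_ω² = F_γ² = 0`.
    have h6 : analyticSignal ω x = 0 := by
      rcases mul_eq_zero.1 h2 with h | h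
      · exact h
      · rw [h, mul_zero] at h1
        exact mul_self_eq_zero.1 h1
    rw [h4, Pi.zero_apply]
    rw [h6] at h3
    simpa using (congrArg Complex.re h3).symm
  have := hω.1
  rw [hω0] at this
  simp at this

/-! ### Bounded functions in `BMO` and `CMO` -/

theorem bmoNorm_le_of_bound {b : ℝ → ℝ} {M : ℝ} (hM : ∀ x, ‖b x‖ ≤ M) :
    bmoNorm b ≤ ENNReal.ofReal (2 * M) := by
  refine iSup_le fun a => iSup_le fun c => iSup_le fun hac => ?_
  have h0 : volume (Icc a c) ≠ 0 := by simp [hac]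
  have hfin : volume (Icc a c) ≠ ∞ := by simp
  have havg : ‖⨍ y in Icc a c, b y‖ ≤ M := by
    have h := norm_setIntegral_le_of_norm_le_const (f := b) hfin.lt_top (fun x _ => hM x)
    have hpos : 0 < volume.real (Icc a c) := ENNReal.toReal_pos h0 hfin
    rw [setAverage_eq, norm_smul, norm_inv, Real.norm_of_nonneg hpos.le, inv_mul_le_iff₀ hpos]
    linarith
  calc ⨍⁻ x in Icc a c, ‖b x - ⨍ y in Icc a c, b y‖ₑ ∂volume
      ≤ ⨍⁻ _ in Icc a c, ENNReal.ofReal (2 * M) ∂volume := by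
        refine laverage_mono_ae (Eventually.of_forall fun x => ?_)
        change ‖b x - ⨍ y in Icc a c, b y‖ₑ ≤ _
        rw [← ofReal_norm]
        refine ENNReal.ofReal_le_ofReal ((norm_sub_le _ _).trans ?_)
        linarith [hM x]
    _ = _ := setLAverage_const h0 hfin _

/-- A smooth function vanishing at infinity belongs to `CMO(ℝ)`. -/
theorem isCMO_of_contDiff_of_tendsto {b : ℝ → ℝ} (hb : ContDiff ℝ (⊤ : ℕ∞) b)
    (h0 : Tendsto b (cocompact ℝ) (𝓝 0)) : IsCMO b := by
  let B : ZeroAtInftyContinuousMap ℝ ℝ := ⟨⟨b, hb.continuous⟩, h0⟩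
  have hB : ∀ x, ‖b x‖ ≤ ‖B.toBCF‖ := fun x => B.toBCF.norm_coe_le_norm x
  refine ⟨⟨hb.continuous.locallyIntegrable, (bmoNorm_le_of_bound hB).trans_lt
    ENNReal.ofReal_lt_top⟩, fun ε hε => ?_⟩
  obtain ⟨r, hr0, hrε⟩ := ENNReal.lt_iff_exists_nnreal_btwn.1 hε
  have hr0 : (0 : ℝ) < r := by exact_mod_cast hr0
  have hev : ∀ᶠ x in cocompact ℝ, ‖b x‖ < r / 2 := by
    simpa using h0.norm.eventually (gt_mem_nhds (by simpa using half_pos hr0))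
  obtain ⟨R, hR⟩ := Metric.closedBall_compl_subset_of_mem_cocompact hev 0
  -- `χ` is `1` wherever `|b|` may reach `r / 2`, so `|b - χb| ≤ r / 2` and the mean oscillation is
  -- at most `r < ε`. The maximum with `1` keeps the inner radius positive.
  let χ : ContDiffBump (0 : ℝ) := ⟨max R 1, max R 1 + 1, by positivity, by linarith⟩
  refine ⟨fun x => χ x * b x, χ.contDiff.mul hb, χ.hasCompactSupport.mul_right, ?_⟩
  refine (bmoNorm_le_of_bound (M := r / 2) fun x => ?_).trans_lt ?_
  · rcases le_or_gt ‖x‖ (max R 1) with hx | hx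
    · have : χ x = 1 := χ.one_of_mem_closedBall (mem_closedBall_zero_iff.2 hx)
      simpa [this] using (half_pos hr0).le
    · have hx' : ‖b x‖ < r / 2 := hR (by
        simpa using lt_of_le_of_lt (le_max_left R 1) hx)
      have h1 : b x - χ x * b x = (1 - χ x) * b x := by ring
      have h2 : ‖1 - χ x‖ ≤ 1 := by
        rw [Real.norm_eq_abs, abs_le]
        constructor <;> linarith [χ.nonneg (x := x), χ.le_one (x := x)]
      change ‖b x - χ x * b x‖ ≤ _
      rw [h1, norm_mul]
      nlinarith [norm_nonneg (b x)]
  · rw [mul_div_cancel₀ _ two_ne_zero, ENNReal.ofReal_coe_nnreal]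
    exact hrε

/-- For bounded `b` the pairing is the integral. -/
theorem pairing_eq_integral {b : ℝ → ℝ} {M : ℝ} (hM : ∀ x, ‖b x‖ ≤ M) (f : Hardy1) :
    pairing b f = ∫ x, b x * Hardy1.fn f x := by
  refine Tendsto.limUnder_eq (tendsto_const_nhds.congr' ?_)
  filter_upwards [eventually_ge_atTop ⌈M⌉₊] with N hN
  have hN : M ≤ N := (Nat.le_ceil M).trans (by exact_mod_cast hN)
  congr 1 with x
  have h := abs_le.1 ((hM x).trans hN)
  rw [min_eq_left h.2, max_eq_right h.1]

/-! ### An extremal symbol -/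

/-- The two-sided exponential `exp (-|ξ|)`. -/
def expAbs (ξ : ℝ) : ℂ := Complex.exp (-(|ξ| : ℝ))

/-- The one-sided exponential `1_{ξ > 0} exp (-ξ)`. -/
def expPos : ℝ → ℂ := (Ioi (0 : ℝ)).indicator expAbs

theorem expAbs_of_nonneg {ξ : ℝ} (h : 0 ≤ ξ) : expAbs ξ = Complex.exp (-ξ) := by
  rw [expAbs, abs_of_nonneg h]

theorem expAbs_of_nonpos {ξ : ℝ} (h : ξ ≤ 0) : expAbs ξ = Complex.exp ξ := by
  rw [expAbs, abs_of_nonpos h, Complex.ofReal_neg, neg_neg]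

theorem continuous_expAbs : Continuous expAbs := by
  unfold expAbs
  fun_prop

theorem norm_expAbs (ξ : ℝ) : ‖expAbs ξ‖ = Real.exp (-|ξ|) := by
  rw [expAbs, Complex.norm_exp]
  simp

theorem conj_expAbs (ξ : ℝ) : conj (expAbs ξ) = expAbs ξ := by
  rw [expAbs, ← Complex.exp_conj, map_neg, Complex.conj_ofReal]

theorem expAbs_neg (ξ : ℝ) : expAbs (-ξ) = expAbs ξ := by
  rw [expAbs, abs_neg, expAbs]

theorem integrable_expAbs : Integrable expAbs := by
  rw [← integrableOn_univ, ← Iic_union_Ioi (a := (0 : ℝ))]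
  refine IntegrableOn.union ?_ ?_
  · refine (integrableOn_exp_mul_complex_Iic (a := 1) (by simp) 0).congr_fun (fun x hx => ?_)
      measurableSet_Iic
    simp [expAbs_of_nonpos hx]
  · refine (integrableOn_exp_mul_complex_Ioi (a := -1) (by simp) 0).congr_fun (fun x hx => ?_)
      measurableSet_Ioi
    simp [expAbs_of_nonneg (le_of_lt hx)]

theorem norm_expAbs_le_one (ξ : ℝ) : ‖expAbs ξ‖ ≤ 1 := by
  rw [norm_expAbs, Real.exp_le_one_iff]
  simp

theorem memLp_expAbs : MemLp expAbs 2 (volume : Measure ℝ) := by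
  refine (memLp_two_iff_integrable_sq_norm continuous_expAbs.aestronglyMeasurable).2 ?_
  refine integrable_expAbs.norm.mono' (by have := continuous_expAbs; fun_prop)
    (Eventually.of_forall fun x => ?_)
  rw [norm_pow, norm_norm]
  nlinarith [norm_nonneg (expAbs x), norm_expAbs_le_one x]

theorem memLp_expPos : MemLp expPos 2 (volume : Measure ℝ) :=
  memLp_expAbs.indicator measurableSet_Ioi

/-- `expAbs` as an element of `L²(ℝ)`. -/
def expAbsL : L2C := memLp_expAbs.toLp expAbs

/-- `expPos` as an element of `L²(ℝ)`. -/
def expPosL : L2C := memLp_expPos.toLp expPos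

theorem coeFn_expAbsL : expAbsL =ᵐ[volume] expAbs := memLp_expAbs.coeFn_toLp

theorem coeFn_expPosL : expPosL =ᵐ[volume] expPos := memLp_expPos.coeFn_toLp

theorem norm_expPosL_sq : ‖expPosL‖ ^ 2 = 1 / 2 := by
  rw [norm_sq_eq_integral]
  have h : ∀ᵐ x : ℝ, ‖expPosL x‖ ^ 2 = (Ioi (0 : ℝ)).indicator (fun x => Real.exp (-2 * x)) x := by
    filter_upwards [coeFn_expPosL] with x hx
    rw [hx, expPos]
    by_cases h0 : x ∈ Ioi (0 : ℝ)
    · rw [indicator_of_mem h0, indicator_of_mem h0, norm_expAbs, abs_of_pos h0, ← Real.exp_nat_mul]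
      congr 1
      push_cast
      ring
    · rw [indicator_of_notMem h0, indicator_of_notMem h0]
      simp
  rw [integral_congr_ae h, integral_indicator measurableSet_Ioi, integral_exp_mul_Ioi (by norm_num)]
  norm_num

/-- The symbol `4 / (1 + (2πx)²)`, twice the Fourier transform of `exp (-|ξ|)`. -/
def cauchySymbol (x : ℝ) : ℝ := 4 / (1 + (2 * Real.pi * x) ^ 2)

theorem cauchySymbol_nonneg (x : ℝ) : 0 ≤ cauchySymbol x := by
  unfold cauchySymbol
  positivity

theorem norm_cauchySymbol_le (x : ℝ) : ‖cauchySymbol x‖ ≤ 4 := by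
  rw [Real.norm_of_nonneg (cauchySymbol_nonneg x), cauchySymbol,
    div_le_iff₀ (by positivity)]
  nlinarith [sq_nonneg (2 * Real.pi * x)]

theorem contDiff_cauchySymbol : ContDiff ℝ (⊤ : ℕ∞) cauchySymbol := by
  unfold cauchySymbol
  exact contDiff_const.div (by fun_prop) fun x => by positivity

/-- With `a = -2πix`, the two half-lines contribute `1/(1 + a)` and `1/(1 - a)`, whose sum is `2/(1
- a²)`. -/
theorem fourier_expAbs (x : ℝ) : 2 * 𝓕 expAbs x = cauchySymbol x := by
  set a : ℂ := -2 * Real.pi * x * Complex.I with ha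
  have hare : a.re = 0 := by simp [ha]
  have hint : Integrable fun v : ℝ => Complex.exp (a * v) * expAbs v := by
    refine integrable_expAbs.bdd_mul (c := 1) (by fun_prop) (Eventually.of_forall fun v => ?_)
    rw [Complex.norm_exp]
    simp [hare]
  have hF : 𝓕 expAbs x = ∫ v : ℝ, Complex.exp (a * v) * expAbs v := by
    rw [Real.fourier_real_eq_integral_exp_smul]
    refine integral_congr_ae (Eventually.of_forall fun v => ?_)
    simp only [smul_eq_mul, ha]
    push_cast
    ring_nf
  have h1 : ∫ v in Iic (0 : ℝ), Complex.exp (a * v) * expAbs v = 1 / (a + 1) := by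
    rw [setIntegral_congr_fun (g := fun v : ℝ => Complex.exp ((a + 1) * v)) measurableSet_Iic,
      integral_exp_mul_complex_Iic (by simp [hare])]
    · simp
    · intro v hv
      simp only [expAbs_of_nonpos hv, ← Complex.exp_add]
      ring_nf
  have h2 : ∫ v in Ioi (0 : ℝ), Complex.exp (a * v) * expAbs v = -1 / (a - 1) := by
    rw [setIntegral_congr_fun (g := fun v : ℝ => Complex.exp ((a - 1) * v)) measurableSet_Ioi,
      integral_exp_mul_complex_Ioi (by simp [hare])]
    · simp
    · intro v hv
      simp only [expAbs_of_nonneg (le_of_lt hv), ← Complex.exp_add]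
      ring_nf
  rw [hF, ← intervalIntegral.integral_Iic_add_Ioi (b := (0 : ℝ)) hint.integrableOn
    hint.integrableOn, h1, h2, cauchySymbol]
  have n1 : a + 1 ≠ 0 := fun h => by simpa [hare] using congrArg Complex.re h
  have n2 : a - 1 ≠ 0 := fun h => by simpa [hare] using congrArg Complex.re h
  have n3 : (1 + (2 * Real.pi * x) ^ 2 : ℂ) ≠ 0 := by
    have : (0 : ℝ) < 1 + (2 * Real.pi * x) ^ 2 := by positivity
    exact_mod_cast this.ne'
  push_cast
  have hsq : (2 * Real.pi * x : ℂ) ^ 2 = -a ^ 2 := by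
    rw [ha]
    linear_combination (4 * (Real.pi : ℂ) ^ 2 * x ^ 2) * Complex.I_sq
  rw [hsq] at n3 ⊢
  clear_value a
  field_simp
  ring

/-- Decay at infinity is the Riemann–Lebesgue lemma, the symbol being the Fourier transform of an
integrable function. -/
theorem isCMO_cauchySymbol : IsCMO cauchySymbol := by
  refine isCMO_of_contDiff_of_tendsto contDiff_cauchySymbol ?_
  have h := (Real.zero_at_infty_fourier expAbs).const_mul 2
  rw [mul_zero] at h
  have h2 := (Complex.continuous_re.tendsto 0).comp h
  refine h2.congr fun x => ?_
  simp [fourier_expAbs]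

/-- The value of the holomorphic extension of the analytic signal at a point of the upper
half-plane, as a functional of its Fourier transform. -/
def evalUpper (ω : L2R) : ℂ := inner ℂ expPosL (𝓕 (analyticSignal ω) : L2C)

theorem conj_expPos (ξ : ℝ) : conj (expPos ξ) = expPos ξ := by
  unfold expPos
  by_cases h : ξ ∈ Ioi (0 : ℝ)
  · rw [indicator_of_mem h, conj_expAbs]
  · rw [indicator_of_notMem h, map_zero]

theorem evalUpper_eq_integral (ω : L2R) :
    evalUpper ω = ∫ ξ, expPos ξ * (𝓕 (analyticSignal ω) : L2C) ξ := by
  rw [evalUpper, L2.inner_def]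
  refine integral_congr_ae ?_
  filter_upwards [coeFn_expPosL] with ξ h
  rw [h, RCLike.inner_apply, conj_expPos, mul_comm]

theorem integrable_expPos_mul (f : L2C) : Integrable fun ξ => expPos ξ * f ξ :=
  memLp_expPos.integrable_mul (Lp.memLp f)

/-- Cauchy–Schwarz: the kernel's `‖expPosL‖² = 1/2` cancels the factor `2` in
`norm_analyticSignal_sq`. -/
theorem norm_evalUpper_sq_le (ω : L2R) : ‖evalUpper ω‖ ^ 2 ≤ ‖ω‖ ^ 2 := by
  have h : ‖evalUpper ω‖ ≤ ‖expPosL‖ * ‖analyticSignal ω‖ := by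
    rw [← Lp.norm_fourier_eq (analyticSignal ω)]
    exact norm_inner_le_norm _ _
  calc ‖evalUpper ω‖ ^ 2 ≤ (‖expPosL‖ * ‖analyticSignal ω‖) ^ 2 := by gcongr
    _ = ‖ω‖ ^ 2 := by
      rw [mul_pow, norm_expPosL_sq, norm_analyticSignal_sq]
      ring

/-- Point evaluation is multiplicative. On the support of the convolution integrand `η` and `ξ - η`
are positive, so `exp (-ξ) = exp (-η) exp (-(ξ - η))`; the left side becomes the integral of a
convolution, hence a product of integrals. -/
theorem integral_expAbs_mul_fourier (ω γ : L2R) :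
    ∫ ξ, expAbs ξ * 𝓕 (fun x => analyticSignal ω x * analyticSignal γ x) ξ
      = evalUpper ω * evalUpper γ := by
  rw [evalUpper_eq_integral, evalUpper_eq_integral]
  have hconv := integral_convolution (ContinuousLinearMap.mul ℂ ℂ)
    (integrable_expPos_mul (𝓕 (analyticSignal ω))) (integrable_expPos_mul (𝓕 (analyticSignal γ)))
  rw [ContinuousLinearMap.mul_apply'] at hconv
  rw [← hconv]
  refine integral_congr_ae (Eventually.of_forall fun ξ => ?_)
  simp only [fourier_mul_eq, convolution, ContinuousLinearMap.mul_apply']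
  rw [← integral_const_mul]
  refine integral_congr_ae ?_
  have h := (Measure.measurePreserving_sub_left (volume : Measure ℝ) ξ).quasiMeasurePreserving.ae
    (fourier_analyticSignal_of_nonpos γ)
  filter_upwards [fourier_analyticSignal_of_nonpos ω, h] with η h1 h2
  rcases le_or_gt η 0 with h3 | h3
  · simp [h1 h3]
  rcases le_or_gt (ξ - η) 0 with h4 | h4
  · simp [h2 h4]
  rw [expPos, indicator_of_mem (by exact h3), indicator_of_mem (by exact h4),
    expAbs_of_nonneg h3.le, expAbs_of_nonneg h4.le, expAbs_of_nonneg (by linarith)]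
  have h5 : Complex.exp (-(ξ : ℂ)) = Complex.exp (-(η : ℂ)) * Complex.exp (-((ξ - η : ℝ) : ℂ)) := by
    rw [← Complex.exp_add]
    push_cast
    ring_nf
  rw [h5]
  ring

theorem pairing_cauchySymbol (ω γ : L2R) :
    pairing cauchySymbol (hardyForm ω γ) = 2 * (evalUpper ω * evalUpper γ).re := by
  rw [pairing_eq_integral norm_cauchySymbol_le, fn_hardyForm]
  set F : ℝ → ℂ := fun x => analyticSignal ω x * analyticSignal γ x with hF
  have hFint : Integrable F := (Lp.memLp (analyticSignal ω)).integrable_mul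
    (Lp.memLp (analyticSignal γ))
  -- The multiplication formula `∫ û v = ∫ u v̂` for integrable functions.
  have hself : ∫ x, 𝓕 expAbs x * F x = ∫ ξ, expAbs ξ * 𝓕 F ξ := by
    simpa using! VectorFourier.integral_fourierIntegral_smul_eq_flip (L := innerₗ ℝ)
      Real.continuous_fourierChar continuous_inner integrable_expAbs hFint
  have hbF : Integrable fun x => (cauchySymbol x : ℂ) * F x := by
    refine hFint.bdd_mul (c := 4) ?_ (Eventually.of_forall fun x => ?_)
    · exact (Complex.continuous_ofReal.comp contDiff_cauchySymbol.continuous).aestronglyMeasurable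
    · rw [Complex.norm_real]
      exact norm_cauchySymbol_le x
  have hre : ∫ x, cauchySymbol x * reForm ω γ x = (∫ x, (cauchySymbol x : ℂ) * F x).re := by
    have h := integral_re (𝕜 := ℂ) hbF
    rw [RCLike.re_to_complex] at h
    rw [← h]
    refine integral_congr_ae ?_
    filter_upwards [reForm_add_imForm ω γ] with x hx
    rw [hF]
    simp only [← hx]
    simp
  rw [hre]
  simp only [← fourier_expAbs, mul_assoc]
  rw [integral_const_mul, hself, integral_expAbs_mul_fourier]
  simp

/-- The real function whose Fourier transform is `r exp (-|ξ|)`. -/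
def extremal (r : ℝ) : L2R := Complex.reCLM.compLp ((r : ℂ) • (𝓕⁻ expAbsL : L2C))

theorem conjL_reflL_expAbsL : conjL (reflL expAbsL) = expAbsL := by
  refine Lp.ext ?_
  have h := (Measure.measurePreserving_neg (volume : Measure ℝ)).quasiMeasurePreserving.ae
    coeFn_expAbsL
  filter_upwards [coeFn_conjL (reflL expAbsL), coeFn_reflL expAbsL, coeFn_expAbsL, h]
    with x h1 h2 h3 h4
  rw [h1, h2, h4, h3, expAbs_neg, conj_expAbs]

theorem conjL_real_smul (r : ℝ) (f : L2C) : conjL ((r : ℂ) • f) = (r : ℂ) • conjL f :=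
  map_smul conjL r f

theorem ofRealL_extremal (r : ℝ) : ofRealL (extremal r) = (r : ℂ) • (𝓕⁻ expAbsL : L2C) := by
  refine ofRealL_re_of_conjL_eq ?_
  rw [conjL_real_smul, ← fourierInv_conjL_reflL, conjL_reflL_expAbsL]

theorem fourier_analyticSignal_extremal (r : ℝ) :
    (𝓕 (analyticSignal (extremal r)) : L2C) = (2 * r : ℂ) • expPosL := by
  refine Lp.ext ?_
  have h := fourier_analyticSignal (extremal r)
  rw [ofRealL_extremal, FourierTransform.fourier_smul,
    FourierTransform.fourier_fourierInv_eq] at h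
  filter_upwards [h, Lp.coeFn_smul (r : ℂ) expAbsL, Lp.coeFn_smul (2 * r : ℂ) expPosL,
    coeFn_expAbsL, coeFn_expPosL, Measure.ae_ne volume (0 : ℝ)] with x h1 h2 h3 h4 h5 h0
  rw [h1, h2, h3, Pi.smul_apply, Pi.smul_apply, h4, h5, expPos, smul_eq_mul, smul_eq_mul]
  rcases lt_or_gt_of_ne h0 with h0 | h0
  · rw [Real.sign_of_neg h0, indicator_of_notMem (by simpa using h0.le)]
    simp
  · rw [Real.sign_of_pos h0, indicator_of_mem (by exact h0)]
    push_cast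
    ring

theorem norm_extremal_sq (r : ℝ) : ‖extremal r‖ ^ 2 = r ^ 2 := by
  have h := norm_analyticSignal_sq (extremal r)
  rw [← Lp.norm_fourier_eq, fourier_analyticSignal_extremal, norm_smul, mul_pow,
    norm_expPosL_sq] at h
  have h2 : ‖(2 * r : ℂ)‖ ^ 2 = 4 * r ^ 2 := by
    rw [norm_mul, Complex.norm_real, mul_pow, Real.norm_eq_abs, sq_abs]
    norm_num
  rw [h2] at h
  linarith

/-- The equality case of Cauchy–Schwarz: the transform of the analytic signal is `2r` times the
kernel, and `2r · 1/2 = r`. -/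
theorem evalUpper_extremal (r : ℝ) : evalUpper (extremal r) = r := by
  rw [evalUpper, fourier_analyticSignal_extremal, inner_smul_right, inner_self_eq_norm_sq_to_K]
  have h : ((‖expPosL‖ : ℂ)) ^ 2 = 1 / 2 := by
    rw [← Complex.ofReal_pow, norm_expPosL_sq]
    norm_num
  erw [h]
  ring

/-! ### The bilinear operator violates the symmetry assumption -/

/-- `2 Re (uv) ≤ 2|u||v| ≤ |u|² + |v|²`, applied to the two point values. -/
theorem pairing_cauchySymbol_le (ω γ : L2R) :
    pairing cauchySymbol (hardyForm ω γ) ≤ ‖ω‖ ^ 2 + ‖γ‖ ^ 2 := by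
  rw [pairing_cauchySymbol]
  have h1 := Complex.re_le_norm (evalUpper ω * evalUpper γ)
  rw [norm_mul] at h1
  nlinarith [norm_evalUpper_sq_le ω, norm_evalUpper_sq_le γ,
    sq_nonneg (‖evalUpper ω‖ - ‖evalUpper γ‖)]

/-- The normalised pair of extremal functions. -/
def extremalPair : WithLp 2 (L2R × L2R) :=
  -- Equal components give equality in the arithmetic–geometric mean step; each has squared norm
  -- `1/2`.
  WithLp.toLp 2 (extremal (Real.sqrt 2)⁻¹, extremal (Real.sqrt 2)⁻¹)

theorem inv_sqrt_two_sq : ((Real.sqrt 2)⁻¹) ^ 2 = (1 / 2 : ℝ) := by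
  rw [inv_pow, Real.sq_sqrt (by norm_num), one_div]

theorem mem_sphere_iff (p : WithLp 2 (L2R × L2R)) :
    p ∈ Metric.sphere (0 : WithLp 2 (L2R × L2R)) 1 ↔ ‖p.fst‖ ^ 2 + ‖p.snd‖ ^ 2 = 1 := by
  rw [mem_sphere_zero_iff_norm, ← WithLp.prod_norm_sq_eq_of_L2,
    pow_eq_one_iff_of_nonneg (norm_nonneg p) two_ne_zero]

theorem extremalPair_mem_sphere : extremalPair ∈ Metric.sphere 0 1 := by
  rw [mem_sphere_iff]
  change ‖extremal _‖ ^ 2 + ‖extremal _‖ ^ 2 = 1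
  rw [norm_extremal_sq, inv_sqrt_two_sq]
  norm_num

theorem pairing_extremalPair : pairing cauchySymbol (bilinearOp extremalPair) = 1 := by
  change pairing cauchySymbol (hardyForm (extremal _) (extremal _)) = 1
  rw [pairing_cauchySymbol, evalUpper_extremal, ← Complex.ofReal_mul, Complex.ofReal_re, ← sq,
    inv_sqrt_two_sq]
  norm_num

theorem normXQ_cauchySymbol : normXQ bilinearOp cauchySymbol = 1 := by
  refine le_antisymm (iSup₂_le fun p hp => ?_) ?_
  · rw [mem_sphere_iff] at hp
    have := pairing_cauchySymbol_le p.fst p.snd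
    rw [hp] at this
    exact_mod_cast this
  · refine le_iSup₂_of_le extremalPair extremalPair_mem_sphere ?_
    rw [pairing_extremalPair]
    simp

/-- The dual norm of the image of any unit vector is at most `1`, by the definition of `normXQ`;
`cauchySymbol` shows that the bound is attained here. -/
theorem extremalPair_mem_classA : extremalPair ∈ classA bilinearOp := by
  refine ⟨extremalPair_mem_sphere, le_antisymm (iSup₂_le fun b hb => ?_) ?_⟩
  · rw [← hb.2]
    exact le_iSup₂_of_le extremalPair extremalPair_mem_sphere le_rfl
  · refine le_iSup₂_of_le cauchySymbol ⟨isCMO_cauchySymbol, normXQ_cauchySymbol⟩ ?_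
    rw [pairing_extremalPair]
    simp

/-- The rotation `(G₁, G₂) ↦ (iG₁, -iG₂)` of pairs of boundary functions. -/
def rotate (p : WithLp 2 (L2R × L2R)) : WithLp 2 (L2R × L2R) :=
  WithLp.toLp 2 (-hilbert p.fst, hilbert p.snd)

/-- On boundary functions this is `(iF₁)(-iF₂) = F₁F₂`; in real terms it uses `H² = -1`. -/
theorem bilinearOp_rotate (p : WithLp 2 (L2R × L2R)) : bilinearOp (rotate p) = bilinearOp p := by
  change hardyForm (-hilbert p.fst) (hilbert p.snd) = hardyForm p.fst p.snd
  refine hardyForm_eq_iff.2 ⟨?_, ?_⟩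
  · simp only [reForm_apply, hilbert_neg, hilbert_hilbert, map_neg, neg_apply, neg_neg]
    abel
  · simp only [imForm_apply, hilbert_neg, hilbert_hilbert, map_neg, neg_apply, neg_neg]
    abel

theorem rotate_mem_classA {p : WithLp 2 (L2R × L2R)} (hp : p ∈ classA bilinearOp) :
    rotate p ∈ classA bilinearOp := by
  refine ⟨?_, ?_⟩
  · rw [mem_sphere_iff]
    change ‖-hilbert p.fst‖ ^ 2 + ‖hilbert p.snd‖ ^ 2 = 1
    rw [norm_neg, norm_hilbert, norm_hilbert]
    exact (mem_sphere_iff p).1 hp.1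
  · rw [bilinearOp_rotate]
    exact hp.2

/-- On boundary functions this is `F₁(-iF₂) + F₂(iF₁) = 0`. By linearity every multiple `c` of the
direction is killed too. -/
theorem bilinearOpDeriv_rotate (p : WithLp 2 (L2R × L2R)) : bilinearOpDeriv p (rotate p) = 0 := by
  change hardyForm p.fst (hilbert p.snd) + hardyForm p.snd (-hilbert p.fst) = 0
  rw [map_neg, ← sub_eq_add_neg, sub_eq_zero]
  refine hardyForm_eq_iff.2 ⟨?_, ?_⟩
  · simp only [reForm_apply, hilbert_hilbert, map_neg, neg_apply, mulL_comm p.snd, mulL_comm (hilbert p.snd)]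
    abel
  · simp only [imForm_apply, hilbert_hilbert, map_neg, neg_apply, mulL_comm p.snd, mulL_comm (hilbert p.snd)]

theorem not_symmetryAssumption_bilinearOp : ¬ SymmetryAssumption bilinearOp := by
  intro h
  obtain ⟨c, -, hc⟩ := h extremalPair extremalPair_mem_classA (rotate extremalPair)
    (rotate_mem_classA extremalPair_mem_classA) (bilinearOp_rotate extremalPair).symm
  refine hc ?_
  rw [(hasLineDerivAt_bilinearOp _ _).lineDeriv, map_smul, bilinearOpDeriv_rotate, smul_zero]

end HilbertQuadratic

end

theorem proposition5p5 :
    -- the quadratic operator `ω ↦ ω² - (Hω)²`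
    (∃ Q : HilbertQuadratic.L2R → HilbertQuadratic.Hardy1,
      (∀ ω : HilbertQuadratic.L2R,
        HilbertQuadratic.Hardy1.fn (Q ω) =ᵐ[volume] fun x => ω x ^ 2 - HilbertQuadratic.hilbert ω x ^ 2) ∧
      HilbertQuadratic.GateauxDifferentiable Q ∧
      HilbertQuadratic.SymmetryAssumption Q) ∧
    -- the bilinear operator `(ω, γ) ↦ ωγ - HωHγ` on the Hilbert space `L²(ℝ) × L²(ℝ)`
    (∃ Q : WithLp 2 (HilbertQuadratic.L2R × HilbertQuadratic.L2R) → HilbertQuadratic.Hardy1,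
      (∀ p : WithLp 2 (HilbertQuadratic.L2R × HilbertQuadratic.L2R),
        HilbertQuadratic.Hardy1.fn (Q p) =ᵐ[volume] fun x => p.fst x * p.snd x -
          HilbertQuadratic.hilbert p.fst x * HilbertQuadratic.hilbert p.snd x) ∧
      HilbertQuadratic.GateauxDifferentiable Q ∧
      ¬ HilbertQuadratic.SymmetryAssumption Q) := by
  refine ⟨⟨HilbertQuadratic.quadraticOp, fun ω => ?_,
    HilbertQuadratic.gateauxDifferentiable_quadraticOp,
    HilbertQuadratic.symmetryAssumption_quadraticOp⟩,
    HilbertQuadratic.bilinearOp, fun p => HilbertQuadratic.coeFn_reForm p.fst p.snd,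
    HilbertQuadratic.gateauxDifferentiable_bilinearOp,
    HilbertQuadratic.not_symmetryAssumption_bilinearOp⟩
  filter_upwards [HilbertQuadratic.coeFn_reForm ω ω] with x hx
  rw [sq, sq, ← hx]
  rfl
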